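/- Theorem 1.5. A *standard space* is a locally compact separable metrizable space. Let $Y$ be a standard space, $X$ a Hausdorff space and $q:Y\to X$ a *pure* quotient map, that is, a quotient map for which there is a dense subset $D$ of $Y$ such that $q|_D$ is injective and such that, for all nets $(d_\alpha)$ in $D$ and $(e_\alpha)$ in $Y$ with the same index set and $q(d_\alpha)=q(e_\alpha)$ for all $\alpha$, if $(d_\alpha)$ eventually escapes from every compact subset of $Y$ then so does $(e_\alpha)$. Let $N$ be the set of points of $X$ that are not $k$-points, where $x\in X$ is a *$k$-point* if for every $E\subseteq X$ with $x\in\overline{E}$ there is a compact set $K\subseteq X$ with $x\in\overline{E\cap K}$. The following are equivalent: 1. $N$ is empty; 2. $X$ is a Fréchet–Urysohn space, i.e. whenever $A\subseteq X$ and $x\in\overline{A}$ there is a sequence in $A$ converging to $x$; 3. there is a closed quotient map from a standard space onto $X$; 4. there is an irreducible closed quotient map from a standard space onto $X$, where a surjective map $p:Z\to X$ is *irreducible* if no proper closed subset $V$ of $Z$ satisfies $p(V)=X$; 5. $X$ has no closed subset homeomorphic to the Arens space $S_2$. Here $S_2$ is the quotient space of the disjoint union of convergent sequences $(y_{n,k})_{k\ge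 0}$ with limit points $y_n$ $(n\ge 0)$, all these points being distinct and the points $y_{n,k}$ isolated, obtained by identifying $y_{0,k}$ with $y_{k+1}$ for every $k\ge 0$. -/

import Mathlib

open Set Filter Topology TopologicalSpace

universe u v w

/-- A standard space: a locally compact separable metrizable space. -/
class IsStandardSpace (Y : Type u) [TopologicalSpace Y] : Prop
    extends MetrizableSpace Y, SeparableSpace Y, LocallyCompactSpace Y

/-- `q` is a pure quotient map: it is a quotient map and there is a dense set `D`, on which `q` is
injective, such that for every net `d` in `D` that eventually escapes from every compact set, every
net `e` in `Y` with `q (d i) = q (e i)` for all `i` also escapes from every compact set. The nets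
are indexed by directed preorders in the universe of `Y`; this is no restriction, since it suffices
to test nets indexed by the compact subsets of `Y`. -/
def IsPureQuotientMap {Y : Type v} {X : Type u} [TopologicalSpace Y] [TopologicalSpace X]
    (q : Y → X) : Prop :=
  IsQuotientMap q ∧
    ∃ D : Set Y, Dense D ∧ InjOn q D ∧
      ∀ (ι : Type v) [Preorder ι] [IsDirectedOrder ι] [Nonempty ι] (d e : ι → Y),
        (∀ i, d i ∈ D) → (∀ i, q (d i) = q (e i)) →
        Tendsto d atTop (cocompact Y) → Tendsto e atTop (cocompact Y)

/-- `x` is a k-point: whenever `x` is in the closure of `E`, it is in the closure of `E ∩ K` for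
some compact set `K`. -/
def IsKPoint {X : Type u} [TopologicalSpace X] (x : X) : Prop :=
  ∀ E : Set X, x ∈ closure E → ∃ K : Set X, IsCompact K ∧ x ∈ closure (E ∩ K)

/-- The set of all points that are not k-points. -/
def nonKPoints (X : Type u) [TopologicalSpace X] : Set X :=
  {x | ¬ IsKPoint x}

/-- A surjective map `q` on `Y` is irreducible if `Y` has no proper closed subset that `q` maps
onto the whole of `X`. -/
def IsIrreducibleMap {Y : Type v} {X : Type u} [TopologicalSpace Y] (q : Y → X) : Prop :=
  Function.Surjective q ∧ ∀ V : Set Y, IsClosed V → q '' V = univ → V = univ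

/-- The disjoint union of countably many convergent sequences: the `n`-th one has the isolated
points `⟨n, k⟩`, `k : ℕ`, and the limit point `⟨n, ∞⟩`. -/
abbrev ArensPresentation : Type := (_ : ℕ) × OnePoint ℕ

/-- The `n`-th isolated point of the first sequence is glued to the limit point of the
`(n + 1)`-st sequence. -/
def ArensRel (a b : ArensPresentation) : Prop :=
  ∃ n : ℕ, a = ⟨0, (n : OnePoint ℕ)⟩ ∧ b = ⟨n + 1, OnePoint.infty⟩

/-- The Arens space `S₂`, with the quotient topology. -/
abbrev ArensSpace : Type := Quot ArensRel

/-! Take a compact exhaustion `L m` of `Y`. The closed sets `q '' L m` determine the topology of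
`X`, absorb every compact set, and closures inside them are reached by sequences; so k-points
everywhere amount to Fréchet–Urysohn. If `X` is Fréchet–Urysohn, purity makes `q` closed
(`isClosedMap_of_dense_of_forall_compact`). A closed map has compact fibres over a dense set as soon
as its fibres over isolated points are compact, and Zorn's lemma then gives a closed subspace on
which `q` is irreducible. Closed images of standard spaces are Fréchet–Urysohn in turn. `S₂` is not
Fréchet–Urysohn, a property that subspaces inherit. Conversely, in a sequential space that is not
Fréchet–Urysohn some sequential closure is not closed; this yields a double sequence, thinned to a
closed copy of `S₂`. -/

section CompactExhaustion

variable {Y : Type v} {X : Type u} [TopologicalSpace Y] [TopologicalSpace X] {q : Y → X}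

theorem CompactExhaustion.isClosed_of_forall_inter (L : CompactExhaustion Y) {S : Set Y}
    (h : ∀ m, IsClosed (S ∩ L m)) : IsClosed S := by
  refine isClosed_of_closure_subset fun y hy => ?_
  obtain ⟨m, hm⟩ := L.exists_mem y
  have h1 : y ∈ closure (interior (L (m + 1)) ∩ S) :=
    isOpen_interior.inter_closure ⟨L.subset_interior_succ m hm, hy⟩
  have h2 : interior (L (m + 1)) ∩ S ⊆ S ∩ L (m + 1) :=
    fun _ hz => ⟨hz.2, interior_subset hz.1⟩
  exact (closure_minimal h2 (h (m + 1)) h1).1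

/-- A Hausdorff quotient of a space with a compact exhaustion carries the weak topology of the
images of the members of the exhaustion. -/
theorem Topology.IsQuotientMap.isClosed_of_forall_inter_image (hq : IsQuotientMap q)
    [T2Space Y] (L : CompactExhaustion Y)
    {S : Set X} (h : ∀ m, IsClosed (S ∩ q '' L m)) : IsClosed S := by
  rw [← hq.isClosed_preimage]
  refine L.isClosed_of_forall_inter fun m => ?_
  have : q ⁻¹' S ∩ L m = q ⁻¹' (S ∩ q '' L m) ∩ L m := by
    ext y
    exact ⟨fun hy => ⟨⟨hy.1, mem_image_of_mem q hy.2⟩, hy.2⟩, fun hy => ⟨hy.1.1, hy.2⟩⟩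
  rw [this]
  exact ((h m).preimage hq.continuous).inter (L.isCompact m).isClosed

theorem Topology.IsQuotientMap.exists_image_superset_of_isCompact [T2Space Y] [T2Space X]
    (hq : IsQuotientMap q) (L : CompactExhaustion Y) {K : Set X} (hK : IsCompact K) :
    ∃ m, K ⊆ q '' L m := by
  by_contra! hcon
  choose x hxK hx using fun m => not_subset.1 (hcon m)
  -- Each `q '' L m` contains `x i` only for `i < m`, so tails are closed; a common point of all
  -- tails would lie in some `q '' L m`.
  have hT : ∀ j, IsClosed (x '' Ici j) := fun j => by
    refine hq.isClosed_of_forall_inter_image L fun m => Set.Finite.isClosed ?_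
    refine ((finite_Iio m).image x).subset ?_
    rintro _ ⟨⟨i, -, rfl⟩, hi⟩
    refine mem_image_of_mem x (not_le.1 fun hmi => hx i (image_mono (L.subset hmi) hi))
  obtain ⟨p, hp⟩ := IsCompact.nonempty_iInter_of_sequence_nonempty_isCompact_isClosed
    (fun j => x '' Ici j) (fun j => image_mono (Ici_subset_Ici.2 j.le_succ))
    (fun j => nonempty_Ici.image x)
    (hK.of_isClosed_subset (hT 0) (by rintro _ ⟨i, -, rfl⟩; exact hxK i)) hT
  rw [mem_iInter] at hp
  obtain ⟨y, rfl⟩ := hq.surjective p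
  obtain ⟨m, hm⟩ := L.exists_mem y
  obtain ⟨i, hi, hiy⟩ := hp m
  exact hx i (hiy ▸ mem_image_of_mem q (L.subset hi hm))

/-- By compactness `x` lifts to a point in the closure of `q ⁻¹' E ∩ L`, where sequences are
available. -/
theorem exists_seq_tendsto_of_mem_closure_inter_image [FrechetUrysohnSpace Y] [T2Space X]
    (hq : Continuous q) {L : Set Y} (hL : IsCompact L) {E : Set X} {x : X}
    (hx : x ∈ closure (E ∩ q '' L)) :
    ∃ s : ℕ → X, (∀ n, s n ∈ E) ∧ Tendsto s atTop (𝓝 x) := by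
  have hc : IsCompact (L ∩ closure (q ⁻¹' E ∩ L)) := hL.inter_right isClosed_closure
  have hsub : E ∩ q '' L ⊆ q '' (L ∩ closure (q ⁻¹' E ∩ L)) := by
    rintro _ ⟨hE, y, hy, rfl⟩
    exact mem_image_of_mem q ⟨hy, subset_closure ⟨hE, hy⟩⟩
  obtain ⟨y, ⟨-, hy⟩, rfl⟩ := closure_minimal hsub (hc.image hq).isClosed hx
  obtain ⟨s, hs, hsy⟩ := mem_closure_iff_seq_limit.1 hy
  exact ⟨q ∘ s, fun n => (hs n).1, (hq.tendsto y).comp hsy⟩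

end CompactExhaustion

/-! ### k-points and the Fréchet–Urysohn property -/

section Frechet

variable {Y : Type v} {X : Type u} [TopologicalSpace Y] [TopologicalSpace X] {q : Y → X}

theorem isKPoint_of_frechetUrysohnSpace [FrechetUrysohnSpace X] (x : X) : IsKPoint x := by
  intro E hE
  obtain ⟨s, hs, hsx⟩ := mem_closure_iff_seq_limit.1 hE
  refine ⟨_, hsx.isCompact_insert_range, mem_closure_of_tendsto hsx (.of_forall fun n => ?_)⟩
  exact ⟨hs n, mem_insert_of_mem _ (mem_range_self n)⟩

theorem Topology.IsQuotientMap.frechetUrysohnSpace_of_isKPoint [T2Space Y] [FrechetUrysohnSpace Y]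
    [T2Space X] (hq : IsQuotientMap q) (L : CompactExhaustion Y) (h : ∀ x : X, IsKPoint x) :
    FrechetUrysohnSpace X := by
  refine ⟨fun E x hx => ?_⟩
  obtain ⟨K, hK, hxK⟩ := h x E hx
  obtain ⟨m, hm⟩ := hq.exists_image_superset_of_isCompact L hK
  exact exists_seq_tendsto_of_mem_closure_inter_image hq.continuous (L.isCompact m)
    (closure_mono (inter_subset_inter_right E hm) hxK)

theorem IsClosedMap.frechetUrysohnSpace [FrechetUrysohnSpace Y] (hc : IsClosedMap q)
    (hq : Continuous q) (hs : Function.Surjective q) : FrechetUrysohnSpace X := by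
  refine ⟨fun E x hx => ?_⟩
  have hsub : E ⊆ q '' closure (q ⁻¹' E) := fun e he => by
    obtain ⟨y, rfl⟩ := hs e
    exact mem_image_of_mem q (subset_closure he)
  obtain ⟨y, hy, rfl⟩ := closure_minimal hsub (hc _ isClosed_closure) hx
  obtain ⟨s, hs, hsy⟩ := mem_closure_iff_seq_limit.1 hy
  exact ⟨q ∘ s, hs, (hq.tendsto y).comp hsy⟩

end Frechet

/-! ### Closedness and irreducible restrictions -/

section Pure

theorem exists_isCompact_superset_inter_preimage_image {Y : Type v} {X : Type u}
    [TopologicalSpace Y] {q : Y → X} {D K : Set Y}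
    (hD : ∀ (ι : Type v) [Preorder ι] [IsDirectedOrder ι] [Nonempty ι] (d e : ι → Y),
      (∀ i, d i ∈ D) → (∀ i, q (d i) = q (e i)) →
      Tendsto d atTop (cocompact Y) → Tendsto e atTop (cocompact Y)) (hK : IsCompact K) :
    ∃ L, IsCompact L ∧ D ∩ q ⁻¹' (q '' K) ⊆ L := by
  by_contra! hcon
  -- The counterexamples, indexed by the compact sets they avoid, form an escaping net whose partner
  -- stays in `K`.
  have key : ∀ C : Compacts Y, ∃ d e, d ∈ D ∧ e ∈ K ∧ q d = q e ∧ d ∉ C := fun C => by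
    obtain ⟨d, ⟨hd, e, he, hde⟩, hC⟩ := not_subset.1 (hcon C C.isCompact)
    exact ⟨d, e, hd, he, hde.symm, hC⟩
  choose d e hd he hde hdC using key
  have hesc : Tendsto d atTop (cocompact Y) := by
    refine (hasBasis_cocompact.tendsto_right_iff).2 fun C hC => ?_
    filter_upwards [eventually_ge_atTop (⟨C, hC⟩ : Compacts Y)] with C' hC' hmem
    exact hdC C' (hC' hmem)
  obtain ⟨C, hC⟩ := ((hD _ d e hd hde hesc).eventually hK.compl_mem_cocompact).exists
  exact hC (he C)

variable {Y : Type v} {X : Type u} [TopologicalSpace Y] [TopologicalSpace X] {q : Y → X}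

/-- A missing limit `x` is approached by images of points of `C` that escape. Density moves these
points into `D`, still far out; but a sequence of such images converging to `x` lies in one `q '' L
m`, so its lifts in `D` cannot escape. -/
theorem isClosedMap_of_dense_of_forall_compact [T2Space Y] [T2Space X]
    [FrechetUrysohnSpace X] (hq : IsQuotientMap q) (L : CompactExhaustion Y) {D : Set Y}
    (hD : Dense D)
    (hK : ∀ K : Set Y, IsCompact K → ∃ L, IsCompact L ∧ D ∩ q ⁻¹' (q '' K) ⊆ L) :
    IsClosedMap q := by
  intro C hC
  by_contra hcl
  obtain ⟨x, hx, hxC⟩ : ∃ x ∈ closure (q '' C), x ∉ q '' C := by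
    by_contra! h
    exact hcl (isClosed_of_closure_subset h)
  have hfar : ∀ n, x ∈ closure (q '' (C \ L n)) := fun n => by
    have h1 : q '' C = q '' (C ∩ L n) ∪ q '' (C \ L n) := by
      rw [← image_union, inter_union_sdiff]
    rw [h1, closure_union] at hx
    refine hx.resolve_left fun h => hxC ?_
    rw [(((L.isCompact n).inter_left hC).image hq.continuous).isClosed.closure_eq] at h
    exact image_mono inter_subset_left h
  obtain ⟨s, hs, hsx⟩ := mem_closure_iff_seq_limit.1 hx
  choose c hc hcs using hs
  have hcn : ∀ n, ∀ᶠ k in atTop, c k ∉ L n := fun n => by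
    have h1 : IsClosed (q '' (C ∩ L n)) :=
      (((L.isCompact n).inter_left hC).image hq.continuous).isClosed
    have h2 : x ∉ q '' (C ∩ L n) := fun h => hxC (image_mono inter_subset_left h)
    filter_upwards [hsx.eventually (h1.isOpen_compl.mem_nhds h2)] with k hk hkL
    exact hk ⟨c k, ⟨hc k, hkL⟩, hcs k⟩
  obtain ⟨φ, hφ, hcφ⟩ := extraction_forall_of_eventually hcn
  have hne : ∀ n, q (c (φ n)) ≠ x := fun n h => hxC ⟨_, hc _, h⟩
  choose U V hU hV hcU hxV hUV using fun n => t2_separation (hne n)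
  have hxU : ∀ n, x ∉ closure (U n) := fun n h =>
    ((hUV n).closure_left (hV n)).le_bot ⟨h, hxV n⟩
  let G : ℕ → Set Y := fun n => q ⁻¹' U n \ L n
  have hG : ∀ n, IsOpen (G n) := fun n =>
    ((hU n).preimage hq.continuous).sdiff (L.isCompact n).isClosed
  have hxE : x ∈ closure (⋃ n, q '' (D ∩ G n)) := by
    refine isClosed_closure.mem_of_tendsto (hsx.comp hφ.tendsto_atTop) (.of_forall fun n => ?_)
    have h1 : c (φ n) ∈ closure (G n ∩ D) :=
      (hG n).inter_closure ⟨⟨hcU n, hcφ n⟩, hD _⟩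
    rw [inter_comm] at h1
    have h2 := image_closure_subset_closure_image hq.continuous (mem_image_of_mem q h1)
    rw [Function.comp_apply, ← hcs]
    exact closure_mono (subset_iUnion (fun n => q '' (D ∩ G n)) n) h2
  obtain ⟨t, ht, htx⟩ := mem_closure_iff_seq_limit.1 hxE
  obtain ⟨m, hm⟩ := hq.exists_image_superset_of_isCompact L htx.isCompact_insert_range
  obtain ⟨M, hM, hDM⟩ := hK (L m) (L.isCompact m)
  obtain ⟨m', hm'⟩ := L.exists_superset_of_isCompact hM
  -- The lifts in `D` lie in `L m'`, while `G n` avoids `L n`, so only `n < m'` occur; these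
  -- finitely many closures miss `x`.
  have hmem : ∀ i, t i ∈ ⋃ n ∈ Iio m', closure (U n) := fun i => by
    obtain ⟨n, d, ⟨hd, hdG⟩, hdt⟩ := mem_iUnion.1 (ht i)
    have h1 : d ∈ L m' := hm' (hDM ⟨hd, by
      rw [mem_preimage, hdt]; exact hm (mem_insert_of_mem _ (mem_range_self i))⟩)
    refine mem_biUnion (x := n) (not_le.1 fun hle => hdG.2 (L.subset hle h1)) ?_
    exact hdt ▸ subset_closure hdG.1
  have := ((finite_Iio m').isClosed_biUnion fun n _ => isClosed_closure (s := U n)).mem_of_tendsto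
    htx (.of_forall hmem)
  simp only [mem_iUnion] at this
  obtain ⟨n, -, hn⟩ := this
  exact hxU n hn

theorem subsingleton_preimage_of_isOpen [T1Space X] (hq : Continuous q) {D : Set Y} (hD : Dense D)
    (hinj : InjOn q D) [T2Space Y] {x : X} (hx : IsOpen {x}) : (q ⁻¹' {x}).Subsingleton := by
  have ho : IsOpen (q ⁻¹' {x}) := hx.preimage hq
  have hs : (q ⁻¹' {x} ∩ D).Subsingleton := fun a ha b hb =>
    hinj ha.2 hb.2 (ha.1.trans hb.1.symm)
  exact hs.closure.anti fun y hy => ho.inter_closure ⟨hy, hD y⟩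

theorem IsClosedMap.dense_setOf_isCompact_preimage [T2Space Y] [T2Space X] [FrechetUrysohnSpace X]
    (hc : IsClosedMap q) (hq : Continuous q) (L : CompactExhaustion Y)
    (hopen : ∀ x : X, IsOpen {x} → IsCompact (q ⁻¹' {x})) :
    Dense {x : X | IsCompact (q ⁻¹' {x})} := by
  intro x
  by_contra hx
  set U := (closure {x : X | IsCompact (q ⁻¹' {x})})ᶜ with hU
  have hUo : IsOpen U := isClosed_closure.isOpen_compl
  have hnc : ∀ z ∈ U, ¬ IsCompact (q ⁻¹' {z}) := fun z hz h => hz (subset_closure h)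
  have hx' : x ∈ closure (U \ {x}) := by
    by_contra h
    refine hnc x hx (hopen x ?_)
    have : {x} = U ∩ (closure (U \ {x}))ᶜ := by
      ext z
      refine ⟨?_, fun hz => by_contra fun hzx => hz.2 (subset_closure ⟨hz.1, hzx⟩)⟩
      rintro rfl
      exact ⟨hx, h⟩
    rw [this]
    exact hUo.inter isClosed_closure.isOpen_compl
  obtain ⟨s, hs, hsx⟩ := mem_closure_iff_seq_limit.1 hx'
  have key : ∀ n, ∃ y, q y = s n ∧ y ∉ L n := fun n => by
    by_contra! h
    refine hnc (s n) (hs n).1 ((L.isCompact n).of_isClosed_subset ?_ h)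
    exact isClosed_singleton.preimage hq
  choose y hy hyL using key
  -- The chosen fibre points escape, so their range is closed, yet its image accumulates at `x`
  -- without containing it.
  have hcl : IsClosed (range y) := by
    refine L.isClosed_of_forall_inter fun m => Set.Finite.isClosed ?_
    refine ((finite_Iio m).image y).subset ?_
    rintro _ ⟨⟨i, rfl⟩, hi⟩
    exact mem_image_of_mem y (not_le.1 fun hmi => hyL i (L.subset hmi hi))
  obtain ⟨_, ⟨i, rfl⟩, hi⟩ := (hc _ hcl).mem_of_tendsto hsx
    (.of_forall fun n => ⟨y n, mem_range_self n, hy n⟩)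
  exact (hs i).2 ((hy i).symm.trans hi)

/-- If the compact fibres of a closed map are dense, then the map is irreducible on some closed
subspace. -/
theorem IsClosedMap.exists_isClosed_irreducible [T2Space Y] (hc : IsClosedMap q)
    (hs : Function.Surjective q) (hd : Dense {x : X | IsCompact (q ⁻¹' {x})}) :
    ∃ V : Set Y, IsClosed V ∧ q '' V = univ ∧
      ∀ W ⊆ V, IsClosed W → q '' W = univ → W = V := by
  have hchains : ∀ c ⊆ {V : Set Y | IsClosed V ∧ q '' V = univ}, IsChain (· ⊆ ·) c → c.Nonempty →
      ∃ V ∈ {V : Set Y | IsClosed V ∧ q '' V = univ}, ∀ W ∈ c, V ⊆ W := by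
    intro c hcS hchain hne
    have hcl : IsClosed (⋂₀ c) := isClosed_sInter fun V hV => (hcS hV).1
    refine ⟨⋂₀ c, ⟨hcl, ?_⟩, fun V hV => sInter_subset_of_mem hV⟩
    -- The image is closed, so it suffices to hit the points with compact fibre, where the finite
    -- intersection property applies.
    rw [← (hc _ hcl).closure_eq]
    refine (hd.mono fun x hx => ?_).closure_eq
    have : Nonempty c := hne.to_subtype
    obtain ⟨y, hy⟩ := IsCompact.nonempty_iInter_of_directed_nonempty_isCompact_isClosed
      (fun V : c => q ⁻¹' {x} ∩ V) (fun A B => by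
        rcases hchain.total A.2 B.2 with h | h
        · exact ⟨A, subset_rfl, inter_subset_inter_right _ h⟩
        · exact ⟨B, inter_subset_inter_right _ h, subset_rfl⟩)
      (fun V => by
        obtain ⟨y, hy, hyx⟩ := (hcS V.2).2.ge (mem_univ x)
        exact ⟨y, hyx, hy⟩)
      (fun V => hx.inter_right (hcS V.2).1)
      (fun V => hx.isClosed.inter (hcS V.2).1)
    rw [mem_iInter] at hy
    exact ⟨y, fun V hV => (hy ⟨V, hV⟩).2, (hy (Classical.arbitrary c)).1⟩
  obtain ⟨V, -, hV⟩ := zorn_superset_nonempty _ hchains univ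
    ⟨isClosed_univ, by rw [image_univ, hs.range_eq]⟩
  exact ⟨V, hV.prop.1, hV.prop.2, fun W hWV hW hqW => hWV.antisymm (hV.le_of_le ⟨hW, hqW⟩ hWV)⟩

end Pure

/-! ### The Arens space and maps out of it -/

theorem OnePoint.tendsto_natCast_infty :
    Tendsto (fun k : ℕ => (k : OnePoint ℕ)) atTop (𝓝 OnePoint.infty) :=
  (OnePoint.continuous_iff_from_nat id).1 continuous_id

namespace ArensSpace

/-- The quotient map that defines the Arens space. -/
abbrev mk : ArensPresentation → ArensSpace := Quot.mk ArensRel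

theorem isQuotientMap_mk : IsQuotientMap mk := isQuotientMap_quot_mk

theorem mk_zero_coe (n : ℕ) : mk ⟨0, (n : OnePoint ℕ)⟩ = mk ⟨n + 1, OnePoint.infty⟩ :=
  Quot.sound ⟨n, rfl, rfl⟩

theorem exists_isClosed_preimage_eq {S : Set ArensPresentation}
    (hS : ∀ n : ℕ, ⟨0, (n : OnePoint ℕ)⟩ ∈ S ↔ ⟨n + 1, OnePoint.infty⟩ ∈ S)
    (hcl : ∀ n, IsClosed (Sigma.mk n ⁻¹' S)) :
    ∃ T : Set ArensSpace, IsClosed T ∧ ∀ p, mk p ∈ T ↔ p ∈ S := by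
  refine ⟨{t | Quot.lift (· ∈ S) (fun a b hab => ?_) t}, ?_, fun p => Iff.rfl⟩
  · obtain ⟨n, rfl, rfl⟩ := hab
    exact propext (hS n)
  · rw [← isQuotientMap_mk.isClosed_preimage]
    exact isClosed_sigma_iff.2 hcl

theorem tendsto_mk (n : ℕ) :
    Tendsto (fun k : ℕ => mk ⟨n, (k : OnePoint ℕ)⟩) atTop (𝓝 (mk ⟨n, OnePoint.infty⟩)) :=
  ((isQuotientMap_mk.continuous.comp continuous_sigmaMk).tendsto _).comp
    OnePoint.tendsto_natCast_infty

/-- A sequence in `E` converging to the limit of row 0 would meet every later row finitely often;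
its range is then closed and misses that limit. -/
theorem not_frechetUrysohnSpace : ¬ FrechetUrysohnSpace ArensSpace := by
  intro _
  set E : Set ArensSpace := {t | ∃ n k : ℕ, mk ⟨n + 1, (k : OnePoint ℕ)⟩ = t} with hE
  have hmem : mk ⟨0, OnePoint.infty⟩ ∈ closure E := by
    refine isClosed_closure.mem_of_tendsto (tendsto_mk 0) (.of_forall fun n => ?_)
    rw [mk_zero_coe]
    exact mem_closure_of_tendsto (tendsto_mk (n + 1)) (.of_forall fun k => ⟨n, k, rfl⟩)
  obtain ⟨s, hs, hlim⟩ := mem_closure_iff_seq_limit.1 hmem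
  choose n k hnk using hs
  have hfin : ∀ N, {i | n i = N}.Finite := fun N => by
    obtain ⟨T, hT, hTS⟩ := exists_isClosed_preimage_eq
      (S := {p | p.1 = N + 1 ∨ p = ⟨0, (N : OnePoint ℕ)⟩}) (fun m => by simp) (fun m => by
        by_cases hm : m = N + 1
        · simp [hm]
        · rcases m with _ | m
          · refine ((finite_singleton (N : OnePoint ℕ)).subset fun x hx => ?_).isClosed
            simpa using hx
          · convert isClosed_empty
            ext x
            simpa using hm)
    have h0 : mk ⟨0, OnePoint.infty⟩ ∉ T := by simp [hTS]
    have h1 := hlim.eventually (hT.isOpen_compl.mem_nhds h0)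
    rw [← Nat.cofinite_eq_atTop] at h1
    refine Set.Finite.subset h1 fun i hi hiT => hiT ?_
    rw [← hnk, hTS]
    exact Or.inl (by rw [← hi])
  obtain ⟨T, hT, hTS⟩ := exists_isClosed_preimage_eq
    (S := {p | ∃ i, p = ⟨n i + 1, (k i : OnePoint ℕ)⟩}) (fun m => by simp) (fun m => by
      refine Set.Finite.isClosed (((hfin (m - 1)).image fun i => (k i : OnePoint ℕ)).subset ?_)
      rintro x ⟨i, hi⟩
      obtain ⟨rfl, hx⟩ := Sigma.mk.inj hi
      exact ⟨i, by simp, (eq_of_heq hx).symm⟩)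
  have h0 : mk ⟨0, OnePoint.infty⟩ ∈ T :=
    hT.mem_of_tendsto hlim (.of_forall fun i => by rw [← hnk, hTS]; exact ⟨i, rfl⟩)
  simp [hTS] at h0

variable {X : Type u}

/-- The map on the disjoint union of convergent sequences that is given by the double sequence `a`,
the sequence `b` of limits of its rows, and the limit `z` of `b`. -/
def presentationMap (z : X) (b : ℕ → X) (a : ℕ → ℕ → X) : ArensPresentation → X
  | ⟨0, x⟩ => x.elim z b
  | ⟨n + 1, x⟩ => x.elim (b n) (a n)

/-- The map on the Arens space that is given by the double sequence `a`, the sequence `b` of limits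
of its rows, and the limit `z` of `b`. -/
def lift (z : X) (b : ℕ → X) (a : ℕ → ℕ → X) : ArensSpace → X :=
  Quot.lift (presentationMap z b a) (by rintro _ _ ⟨n, rfl, rfl⟩; rfl)

theorem lift_injective {z : X} {b : ℕ → X} {a : ℕ → ℕ → X} (hb : Function.Injective b)
    (ha : ∀ n k n' k', a n k = a n' k' → n = n' ∧ k = k') (hbz : ∀ n, b n ≠ z)
    (hab : ∀ n k m, a n k ≠ b m) (haz : ∀ n k, a n k ≠ z) :
    Function.Injective (lift z b a) := by
  have hcases : ∀ t : ArensSpace, t = mk ⟨0, OnePoint.infty⟩ ∨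
      (∃ n, t = mk ⟨n + 1, OnePoint.infty⟩) ∨ ∃ n k : ℕ, t = mk ⟨n + 1, (k : OnePoint ℕ)⟩ := by
    rintro ⟨_ | n, x⟩
    · induction x using OnePoint.rec with
      | infty => exact Or.inl rfl
      | coe k => exact Or.inr (Or.inl ⟨k, mk_zero_coe k⟩)
    · induction x using OnePoint.rec with
      | infty => exact Or.inr (Or.inl ⟨n, rfl⟩)
      | coe k => exact Or.inr (Or.inr ⟨n, k, rfl⟩)
  intro s t hst
  rcases hcases s with rfl | ⟨n, rfl⟩ | ⟨n, k, rfl⟩ <;>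
    rcases hcases t with rfl | ⟨m, rfl⟩ | ⟨m, l, rfl⟩
  · rfl
  · exact absurd hst.symm (hbz m)
  · exact absurd hst.symm (haz m l)
  · exact absurd hst (hbz n)
  · rw [hb hst]
  · exact absurd hst.symm (hab m l n)
  · exact absurd hst (haz n k)
  · exact absurd hst (hab n k m)
  · obtain ⟨rfl, rfl⟩ := ha n k m l hst
    rfl

variable [TopologicalSpace X]

theorem continuous_lift_comp_mk {z : X} {b : ℕ → X} {a : ℕ → ℕ → X}
    (hb : Tendsto b atTop (𝓝 z)) (ha : ∀ n, Tendsto (a n) atTop (𝓝 (b n))) :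
    Continuous (lift z b a ∘ mk) := by
  refine continuous_sigma fun n => ?_
  rw [OnePoint.continuous_iff_from_nat]
  rcases n with _ | n
  exacts [hb, ha n]

/-- Each row has compact image, and `K m` meets only finitely many rows apart from their limits,
which already belong to row 0. -/
theorem isClosedMap_lift [T2Space X] {z : X} {b : ℕ → X} {a : ℕ → ℕ → X} {K : ℕ → Set X}
    (hK : ∀ m, IsClosed (K m)) (hKS : ∀ S : Set X, (∀ m, IsClosed (S ∩ K m)) → IsClosed S)
    (hb : Tendsto b atTop (𝓝 z)) (ha : ∀ n, Tendsto (a n) atTop (𝓝 (b n)))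
    (haK : ∀ m, ∃ N, ∀ n ≥ N, ∀ k, a n k ∉ K m) :
    IsClosedMap (lift z b a) := by
  intro C hC
  have hcont := continuous_lift_comp_mk hb ha
  set F : ℕ → Set X := fun n => (fun x => lift z b a (mk ⟨n, x⟩)) '' {x | mk ⟨n, x⟩ ∈ C} with hF
  have hFcl : ∀ n, IsClosed (F n) := fun n => by
    have h1 : IsClosed {x : OnePoint ℕ | mk ⟨n, x⟩ ∈ C} :=
      hC.preimage (isQuotientMap_mk.continuous.comp continuous_sigmaMk)
    exact (h1.isCompact.image (hcont.comp continuous_sigmaMk)).isClosed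
  refine hKS _ fun m => ?_
  obtain ⟨N, hN⟩ := haK m
  have : lift z b a '' C ∩ K m = (⋃ n ∈ Iic N, F n) ∩ K m := by
    refine Subset.antisymm ?_ ?_
    · rintro _ ⟨⟨⟨n, x⟩, ht, rfl⟩, hm⟩
      refine ⟨?_, hm⟩
      by_cases hn : n ≤ N
      · exact mem_biUnion hn ⟨x, ht, rfl⟩
      · obtain ⟨n, rfl⟩ : ∃ j, n = j + 1 := ⟨n - 1, by omega⟩
        induction x using OnePoint.rec with
        | infty =>
          refine mem_biUnion (x := 0) (Nat.zero_le N) ⟨(n : OnePoint ℕ), ?_, rfl⟩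
          rw [mem_ofPred_eq, mk_zero_coe]
          exact ht
        | coe k => exact absurd hm (hN n (by omega) k)
    · refine inter_subset_inter_left _ (iUnion₂_subset fun n _ => ?_)
      rintro _ ⟨x, hx, rfl⟩
      exact mem_image_of_mem _ hx
  rw [this]
  exact ((finite_Iic N).isClosed_biUnion fun n _ => hFcl n).inter (hK m)

end ArensSpace

/-! ### Finding a closed copy of the Arens space -/

section NotFrechet

variable {X : Type u} [TopologicalSpace X]

theorem exists_injective_tendsto_of_tendsto [T1Space X] {s : ℕ → X} {x : X}
    (hs : Tendsto s atTop (𝓝 x)) (hne : ∀ n, s n ≠ x) :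
    ∃ t : ℕ → X, Function.Injective t ∧ (∀ n, t n ∈ range s) ∧ Tendsto t atTop (𝓝 x) := by
  have hinf : (range s).Infinite := fun hfin => by
    obtain ⟨n, hn⟩ := hfin.isClosed.mem_of_tendsto hs (.of_forall mem_range_self)
    exact hne n hn
  let g := hinf.natEmbedding
  have hg : Function.Injective fun n => (g n : X) := Subtype.val_injective.comp g.injective
  refine ⟨fun n => g n, hg, fun n => (g n).2, fun U hU => ?_⟩
  have h1 := hs hU
  rw [← Nat.cofinite_eq_atTop] at h1 ⊢
  refine Set.Finite.subset ((h1.image s).preimage hg.injOn) fun n hn => ?_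
  obtain ⟨i, hi⟩ := (g n).2
  exact ⟨i, fun hiU => hn (by rw [mem_preimage, ← hi]; exact hiU), hi⟩

/-- A Hausdorff sequential space that is not Fréchet–Urysohn contains a closed copy of the Arens
space, if it has the weak topology of a sequence of closed subspaces whose closures are given by
sequences. -/
theorem exists_isClosedEmbedding_arensSpace [T2Space X] [SequentialSpace X] {K : ℕ → Set X}
    (hK : ∀ m, IsClosed (K m)) (hKS : ∀ S : Set X, (∀ m, IsClosed (S ∩ K m)) → IsClosed S)
    (hKF : ∀ m E, closure (E ∩ K m) ⊆ seqClosure E) (hX : ¬ FrechetUrysohnSpace X) :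
    ∃ f : ArensSpace → X, IsClosedEmbedding f := by
  obtain ⟨A, hA⟩ : ∃ A : Set X, ¬ closure A ⊆ seqClosure A := by
    by_contra! h
    exact hX ⟨fun A => h A⟩
  obtain ⟨c, z, hcA, hcz, hz⟩ : ∃ (c : ℕ → X) (z : X), (∀ n, c n ∈ seqClosure A) ∧
      Tendsto c atTop (𝓝 z) ∧ z ∉ seqClosure A := by
    by_contra! h
    have : IsSeqClosed (seqClosure A) := fun c z hc hcz => h c z hc hcz
    exact hA (closure_minimal subset_seqClosure this.isClosed)
  -- Keeping the limits `b` outside `A` makes them distinct from all row entries.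
  have hcnA : ∀ᶠ n in atTop, c n ∉ A := by
    by_contra h
    obtain ⟨φ, hφ, hφA⟩ := extraction_of_frequently_atTop (not_eventually.1 h)
    exact hz ⟨c ∘ φ, fun n => not_not.1 (hφA n), hcz.comp hφ.tendsto_atTop⟩
  obtain ⟨M, hM⟩ := eventually_atTop.1 hcnA
  obtain ⟨b, hbinj, hbc, hbz⟩ := exists_injective_tendsto_of_tendsto
    ((tendsto_add_atTop_iff_nat M).2 hcz) (fun n h => hz (h ▸ hcA _))
  have hbA : ∀ n, b n ∈ seqClosure A ∧ b n ∉ A := fun n => by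
    obtain ⟨i, hi⟩ := hbc n
    rw [← hi]
    exact ⟨hcA _, hM _ (Nat.le_add_left M i)⟩
  have hrow : ∀ n, ∃ a : ℕ → X, Function.Injective a ∧ (∀ k, a k ∈ A) ∧
      Tendsto a atTop (𝓝 (b n)) := fun n => by
    obtain ⟨s, hsA, hs⟩ := (hbA n).1
    obtain ⟨a, ha, has, hlim⟩ := exists_injective_tendsto_of_tendsto hs
      (fun k h => (hbA n).2 (h ▸ hsA k))
    refine ⟨a, ha, fun k => ?_, hlim⟩
    obtain ⟨i, hi⟩ := has k
    exact hi ▸ hsA i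
  choose a hainj haA ha using hrow
  -- Row `n` is cut down to avoid `B n`: the first part makes rows disjoint, the second makes each
  -- `K m` meet only finitely many rows.
  let B : ℕ → Set X := fun n => (⋃ j ∈ Iio n, insert (b j) (range (a j))) ∪
    ⋃ m ∈ {m | m ≤ n ∧ b n ∉ closure (A ∩ K m)}, closure (A ∩ K m)
  have hBcl : ∀ n, IsClosed (B n) := fun n =>
    ((finite_Iio n).isClosed_biUnion fun j _ => (ha j).isCompact_insert_range.isClosed).union
      (((finite_Iic n).subset fun _ h => h.1).isClosed_biUnion fun _ _ => isClosed_closure)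
  have hbB : ∀ n, b n ∉ B n := by
    rintro n (h | h)
    · obtain ⟨j, hj, h | ⟨k, hk⟩⟩ := mem_iUnion₂.1 h
      · exact (ne_of_gt hj) (hbinj h)
      · exact (hbA n).2 (hk ▸ haA j k)
    · obtain ⟨m, hm, h⟩ := mem_iUnion₂.1 h
      exact hm.2 h
  have htail : ∀ n, ∃ p, ∀ k ≥ p, a n k ∉ B n := fun n =>
    eventually_atTop.1 ((ha n).eventually ((hBcl n).isOpen_compl.mem_nhds (hbB n)))
  choose p hp using htail
  have haz : ∀ n k, a n k ≠ z := fun n k h => hz (subset_seqClosure (h ▸ haA n k))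
  have hlt : ∀ n k n' k', n < n' → a n k ≠ a n' (k' + p n') := fun n k n' k' hn h =>
    hp n' _ (Nat.le_add_left _ _) (Or.inl (mem_biUnion (x := n) hn
      (mem_insert_of_mem _ ⟨k, h⟩)))
  have hlim : ∀ n, Tendsto (fun k => a n (k + p n)) atTop (𝓝 (b n)) := fun n =>
    (tendsto_add_atTop_iff_nat (p n)).2 (ha n)
  refine ⟨ArensSpace.lift z b fun n k => a n (k + p n),
    .of_continuous_injective_isClosedMap ?_ ?_ ?_⟩
  · exact ArensSpace.isQuotientMap_mk.continuous_iff.2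
      (ArensSpace.continuous_lift_comp_mk hbz hlim)
  · refine ArensSpace.lift_injective hbinj (fun n k n' k' h => ?_)
      (fun n h => hz (h ▸ (hbA n).1)) (fun n k m h => (hbA m).2 (h ▸ haA n _)) (fun n k => haz n _)
    rcases lt_trichotomy n n' with hn | rfl | hn
    · exact absurd h (hlt _ _ _ _ hn)
    · exact ⟨rfl, Nat.add_right_cancel (hainj n h)⟩
    · exact absurd h.symm (hlt _ _ _ _ hn)
  · refine ArensSpace.isClosedMap_lift hK hKS hbz hlim fun m => ?_
    -- Hence `b n` also leaves this closure eventually, and once `n ≥ m` the closure is part of `B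
    -- n`.
    have hzm : z ∉ closure (A ∩ K m) := fun h => hz (hKF m A h)
    obtain ⟨N, hN⟩ := eventually_atTop.1
      (hbz.eventually (isClosed_closure.isOpen_compl.mem_nhds hzm))
    refine ⟨max N m, fun n hn k hk => hp n (k + p n) (Nat.le_add_left _ _) (Or.inr ?_)⟩
    exact mem_biUnion (x := m) ⟨le_of_max_le_right hn, hN n (le_of_max_le_left hn)⟩
      (subset_closure ⟨haA n _, hk⟩)

end NotFrechet

/-! ### Standard spaces and the equivalences -/

section Standard

variable {Y : Type v} [TopologicalSpace Y]

instance (priority := 100) IsStandardSpace.secondCountableTopology [IsStandardSpace Y] :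
    SecondCountableTopology Y := by
  let _ := metrizableSpaceMetric Y
  exact UniformSpace.secondCountable_of_separable Y

theorem IsStandardSpace.of_isClosedEmbedding [IsStandardSpace Y] {Z : Type w} [TopologicalSpace Z]
    {f : Z → Y} (hf : IsClosedEmbedding f) : IsStandardSpace Z := by
  have := hf.isEmbedding.metrizableSpace
  have := hf.isEmbedding.secondCountableTopology
  have := hf.locallyCompactSpace
  exact {}

/-- Embedding into `ℓ^∞` gives a copy in the lowest universe, which can be lifted to any other. -/
theorem exists_homeomorph_of_metrizable_secondCountable [MetrizableSpace Y]
    [SecondCountableTopology Y] : ∃ (Z : Type w) (_ : TopologicalSpace Z), Nonempty (Z ≃ₜ Y) := by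
  obtain ⟨f, hf⟩ := exists_embedding_l_infty Y
  exact ⟨ULift.{w} (range f), inferInstance,
    ⟨Homeomorph.ulift.trans hf.toHomeomorph.symm⟩⟩

theorem IsPureQuotientMap.isClosedMap {X : Type u} [TopologicalSpace X] [T2Space X]
    [IsStandardSpace Y] [FrechetUrysohnSpace X] {q : Y → X} (hq : IsPureQuotientMap q) :
    IsClosedMap q := by
  obtain ⟨hq, D, hD, -, hnet⟩ := hq
  exact isClosedMap_of_dense_of_forall_compact hq default hD fun K hK =>
    exists_isCompact_superset_inter_preimage_image hnet hK

theorem IsPureQuotientMap.exists_irreducible {X : Type u} [TopologicalSpace X] [T2Space X]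
    [IsStandardSpace Y] [FrechetUrysohnSpace X] {q : Y → X} (hq : IsPureQuotientMap q) :
    ∃ (Z : Type w) (_ : TopologicalSpace Z) (_ : IsStandardSpace Z) (p : Z → X),
      IsQuotientMap p ∧ IsClosedMap p ∧ IsIrreducibleMap p := by
  have hc := hq.isClosedMap
  obtain ⟨hq, D, hD, hinj, -⟩ := hq
  obtain ⟨V, hV, hqV, hmin⟩ := hc.exists_isClosed_irreducible hq.surjective
    (hc.dense_setOf_isCompact_preimage hq.continuous default fun x hx =>
      (subsingleton_preimage_of_isOpen hq.continuous hD hinj hx).finite.isCompact)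
  obtain ⟨Z, _, ⟨e⟩⟩ := exists_homeomorph_of_metrizable_secondCountable.{v, w} (Y := V)
  have he : IsClosedEmbedding (Subtype.val ∘ e) :=
    hV.isClosedEmbedding_subtypeVal.comp e.isClosedEmbedding
  have hrange : range (Subtype.val ∘ e) = V := by
    rw [e.surjective.range_comp, Subtype.range_coe]
  have hpc : IsClosedMap (q ∘ Subtype.val ∘ e) := hc.comp he.isClosedMap
  have hps : Function.Surjective (q ∘ Subtype.val ∘ e) := by
    rw [← range_eq_univ, range_comp, hrange, hqV]
  refine ⟨Z, _, .of_isClosedEmbedding he, q ∘ Subtype.val ∘ e,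
    hpc.isQuotientMap (hq.continuous.comp he.continuous) hps, hpc, hps, fun W hW hqW => ?_⟩
  have h1 : (Subtype.val ∘ e) '' W = V :=
    hmin _ ((image_subset_range _ W).trans hrange.subset) (he.isClosedMap W hW)
      (by rw [← image_comp, hqW])
  exact he.injective.image_injective (h1.trans (hrange.symm.trans image_univ.symm))

end Standard

theorem theorem1p5 {Y : Type v} {X : Type u} [TopologicalSpace Y] [IsStandardSpace Y]
    [TopologicalSpace X] [T2Space X] (q : Y → X) (hq : IsPureQuotientMap q) :
    List.TFAE [
      nonKPoints X = ∅,
      FrechetUrysohnSpace X,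
      ∃ (Z : Type w) (_ : TopologicalSpace Z) (_ : IsStandardSpace Z) (p : Z → X),
        IsQuotientMap p ∧ IsClosedMap p,
      ∃ (Z : Type w) (_ : TopologicalSpace Z) (_ : IsStandardSpace Z) (p : Z → X),
        IsQuotientMap p ∧ IsClosedMap p ∧ IsIrreducibleMap p,
      ¬ ∃ A : Set X, IsClosed A ∧ Nonempty (A ≃ₜ ArensSpace)] := by
  let L : CompactExhaustion Y := default
  tfae_have 1 → 2 := fun h => hq.1.frechetUrysohnSpace_of_isKPoint L fun x =>
    not_not.1 (eq_empty_iff_forall_notMem.1 h x)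
  tfae_have 2 → 1 := fun _ => eq_empty_of_forall_notMem fun x hx =>
    hx (isKPoint_of_frechetUrysohnSpace x)
  tfae_have 2 → 4 := fun _ => hq.exists_irreducible
  tfae_have 4 → 3 := fun ⟨Z, tZ, sZ, p, hp, hpc, _⟩ => ⟨Z, tZ, sZ, p, hp, hpc⟩
  tfae_have 3 → 2 := fun ⟨_, _, _, _, hp, hpc⟩ => hpc.frechetUrysohnSpace hp.continuous hp.surjective
  tfae_have 2 → 5 := by
    rintro _ ⟨A, -, ⟨e⟩⟩
    exact ArensSpace.not_frechetUrysohnSpace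
      (IsInducing.subtypeVal.comp e.symm.isInducing).frechetUrysohnSpace
  tfae_have 5 → 2 := fun h => by
    by_contra hX
    have : SequentialSpace X := hq.1.sequentialSpace
    obtain ⟨f, hf⟩ := exists_isClosedEmbedding_arensSpace (K := fun m => q '' L m)
      (fun m => ((L.isCompact m).image hq.1.continuous).isClosed)
      (fun S hS => hq.1.isClosed_of_forall_inter_image L hS)
      (fun m E x hx => exists_seq_tendsto_of_mem_closure_inter_image hq.1.continuous
        (L.isCompact m) hx) hX
    exact h ⟨range f, hf.isClosed_range, ⟨hf.isEmbedding.toHomeomorph.symm⟩⟩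
  tfae_finish
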